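/- Let $0<\alpha<1$, $\lambda>0$, $n\ge 1$, let $\tau_1,\dots,\tau_n\ge 0$ be delays and $v=\max_j\tau_j$, with $0<v\le T$. Let $b_j\in C[0,T]$ with $B_j=\sup_{t\in[0,T]}|b_j(t)|$, and let $g_j:C[-v,T]\to C[-v,T]$ satisfy $g_j(0)\ne 0$ and, for some $l_j>0$, $$\|g_j(x)-g_j(y)\|_{C[-v,T]}\le l_j\|x-y\|_{C[-v,T]}\qquad (x,y\in C[-v,T]),$$ all spaces being real-valued and carrying the sup norm. (For example, $g_j$ may be composition with a real $l_j$-Lipschitz function $\gamma_j$ with $\gamma_j(0)\neq0$; then $g_j(x)(t-\tau_j)=\gamma_j(x(t-\tau_j))$.) Assume $$T^\alpha\sum_{j=1}^n B_jl_j<\Gamma(\alpha+1).$$ For $\psi\in C[-v,0]$ with $\psi(0)=0$ consider the problem $${}^{C}D_{0+}^{\alpha}x(t)+\lambda x(t)=\sum_{j=1}^n b_j(t)\,g_j(x)(t-\tau_j)\quad(t\in[0,T]),\qquad x(t)=\psi(t)\quad(t\in[-v,0]),$$ where ${}^{C}D_{0+}^{\alpha}x(t)=\frac{d}{dt}\,\frac1{\Gamma(1-\alpha)}\int_0^t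 (t-s)^{-\alpha}\,(x(s)-x(0))\,ds$ is the Caputo derivative (one-sided derivative at $t=0$ and $t=T$). Then for every such $\psi$ the problem has a unique solution $x_\psi\in C[-v,T]$, and it depends continuously on $\psi$: the map $\psi\mapsto x_\psi$ is continuous from $\{\psi\in C[-v,0]:\psi(0)=0\}$ to $C[-v,T]$. Explicitly, for all such $\psi_1,\psi_2$, with solutions $x_1,x_2$, $$\|x_1-x_2\|_{C[0,T]}\le \frac{T^\alpha\sum_{j=1}^n B_jl_j}{\Gamma(\alpha+1)-T^\alpha\sum_{j=1}^n B_jl_j}\,\|\psi_1-\psi_2\|_{C[-v,0]}.$$ -/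

import Mathlib

open Set

noncomputable section

/-- The value at a real number `t` of a continuous function on `[a, b]`. It is only meant for
`t ∈ [a, b]`; outside that interval it is `0`. -/
def evalOn {a b : ℝ} (x : C(Icc a b, ℝ)) (t : ℝ) : ℝ :=
  open Classical in if h : t ∈ Icc a b then x ⟨t, h⟩ else 0

/-- The restriction to `[0, T]` of a continuous function on `[-v, T]`. -/
def restrictNonneg {v T : ℝ} (hv : 0 < v) (x : C(Icc (-v) T, ℝ)) : C(Icc (0 : ℝ) T, ℝ) :=
  x.comp ⟨Set.inclusion (Icc_subset_Icc_left (neg_nonpos.mpr hv.le)), continuous_inclusion _⟩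

/-- The Riemann–Liouville fractional integral of order `β > 0` with base point `0`:
`(I^β f)(t) = Γ(β)⁻¹ ∫₀ᵗ (t - s)^(β - 1) f(s) ds`. -/
def rlIntegral (β : ℝ) (f : ℝ → ℝ) (t : ℝ) : ℝ :=
  (Real.Gamma β)⁻¹ * ∫ s in (0 : ℝ)..t, (t - s) ^ (β - 1) * f s

/-- The Caputo derivative of order `α ∈ (0, 1)` with base point `0` of `f`, on `[0, T]`, exists at
`t` and equals `d`. It is the Riemann–Liouville derivative `d/dt I^(1 - α)` of `f - f 0`, the
derivative being one-sided at the end points of `[0, T]`. -/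
def HasCaputoDerivAt (α T : ℝ) (f : ℝ → ℝ) (d t : ℝ) : Prop :=
  HasDerivWithinAt (rlIntegral (1 - α) (fun s => f s - f 0)) d (Icc 0 T) t

/-- `x ∈ C[-v, T]` solves the delay problem
`ᶜD^α x(t) + lam x(t) = ∑ j, b j (t) * (g j x)(t - τ j)` for `t ∈ [0, T]`, with
`x = ψ` on `[-v, 0]`. For `g j` of the form `(g j x)(s) = γ j (x s)`, with a real function `γ j`,
the delayed terms are `b j (t) * γ j (x (t - τ j))`. -/
def IsSolution {n : ℕ} {v T : ℝ} (α lam : ℝ) (τ : Fin n → ℝ) (b : Fin n → C(Icc (0 : ℝ) T, ℝ))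
    (g : Fin n → C(Icc (-v) T, ℝ) → C(Icc (-v) T, ℝ))
    (ψ : C(Icc (-v) (0 : ℝ), ℝ)) (x : C(Icc (-v) T, ℝ)) : Prop :=
  (∀ t ∈ Icc (-v) 0, evalOn x t = evalOn ψ t) ∧
  ∀ t ∈ Icc 0 T, ∃ d : ℝ, HasCaputoDerivAt α T (evalOn x) d t ∧
    d + lam * evalOn x t = ∑ j, evalOn (b j) t * evalOn (g j x) (t - τ j)

end

open MeasureTheory Filter Topology

/-! Inverting the Caputo derivative turns the equation into x = I^α(N x - lam x) on [0, T], where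
the delay term N is Lipschitz with constant B = ∑ ‖b j‖ l j. Putting -lam x into the contraction
would bring lam into the smallness condition. Instead the linear part is inverted: R h is the
solution of x = I^α(h - lam x). The crux is that R is Lipschitz with constant T^α / Γ(α + 1),
whatever lam ≥ 0 is. Gluing ψ to R(N x) is then a contraction in x with constant q = T^α B / Γ(α +
1) < 1. Two fixed points differ by at most ‖ψ₁ - ψ₂‖ / (1 - q) on [-v, T], and one more application
of R ∘ N gives the factor q / (1 - q) on [0, T].

The bound uniform in lam (`abs_rlIntegral_le_of_abs_add_le`) comes from a maximum principle
(`nonneg_of_isMaxOn_rlIntegral`), with no Mittag-Leffler kernel: f ≥ 0 at a positive maximum of I^α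
f. It is proved for Lipschitz f and extended by Weierstrass approximation. Because the bound ignores
lam, continuation in lam by steps of fixed length yields R (`exists_linear_equation`). The passage
to the integral equation rests on I^(1 - α) I^α = I^1 (`rlIntegral_rlIntegral_one_sub`). -/

/-! ### Elementary properties of the fractional integral -/

theorem intervalIntegrable_sub_rpow {β : ℝ} (hβ : 0 < β) (t a b : ℝ) :
    IntervalIntegrable (fun s => (t - s) ^ (β - 1)) volume a b := by
  have := (intervalIntegral.intervalIntegrable_rpow' (a := t - a) (b := t - b)
    (r := β - 1) (by linarith))
  simpa using this.comp_sub_left t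

theorem integral_sub_rpow {β : ℝ} (hβ : 0 < β) (t a : ℝ) :
    ∫ s in a..t, (t - s) ^ (β - 1) = (t - a) ^ β / β := by
  rw [intervalIntegral.integral_comp_sub_left (fun s => s ^ (β - 1)) t,
    integral_rpow (Or.inl (by linarith))]
  simp [Real.zero_rpow hβ.ne']

theorem intervalIntegrable_sub_rpow_mul {β : ℝ} (hβ : 0 < β) {f : ℝ → ℝ} {T c a b : ℝ}
    (hf : ContinuousOn f (Icc 0 T)) (ha : 0 ≤ a) (hab : a ≤ b) (hb : b ≤ T) :
    IntervalIntegrable (fun s => (c - s) ^ (β - 1) * f s) volume a b := by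
  refine (intervalIntegrable_sub_rpow hβ c a b).mul_continuousOn (hf.mono ?_)
  rw [uIcc_of_le hab]
  exact Icc_subset_Icc ha hb

theorem rlIntegral_congr {β t : ℝ} {f g : ℝ → ℝ} (ht : 0 ≤ t) (h : ∀ s ∈ Icc 0 t, f s = g s) :
    rlIntegral β f t = rlIntegral β g t := by
  unfold rlIntegral
  congr 1
  refine intervalIntegral.integral_congr fun s hs => ?_
  rw [uIcc_of_le ht] at hs
  simp only [h s hs]

theorem rlIntegral_zero_right (β : ℝ) (f : ℝ → ℝ) : rlIntegral β f 0 = 0 := by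
  simp [rlIntegral]

theorem rlIntegral_sub {β T t : ℝ} (hβ : 0 < β) {f g : ℝ → ℝ} (hf : ContinuousOn f (Icc 0 T))
    (hg : ContinuousOn g (Icc 0 T)) (ht : t ∈ Icc 0 T) :
    rlIntegral β (fun s => f s - g s) t = rlIntegral β f t - rlIntegral β g t := by
  unfold rlIntegral
  rw [← mul_sub, ← intervalIntegral.integral_sub]
  · simp only [mul_sub]
  · exact intervalIntegrable_sub_rpow_mul hβ hf le_rfl ht.1 ht.2
  · exact intervalIntegrable_sub_rpow_mul hβ hg le_rfl ht.1 ht.2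

theorem rlIntegral_const {β : ℝ} (hβ : 0 < β) (C t : ℝ) :
    rlIntegral β (fun _ => C) t = C * t ^ β / Real.Gamma (β + 1) := by
  unfold rlIntegral
  rw [intervalIntegral.integral_mul_const, integral_sub_rpow hβ, Real.Gamma_add_one hβ.ne', sub_zero]
  have := (Real.Gamma_pos_of_pos hβ).ne'
  field_simp

theorem rlIntegral_mono {β T t : ℝ} (hβ : 0 < β) {f g : ℝ → ℝ} (hf : ContinuousOn f (Icc 0 T))
    (hg : ContinuousOn g (Icc 0 T)) (ht : t ∈ Icc 0 T) (h : ∀ s ∈ Icc 0 T, f s ≤ g s) :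
    rlIntegral β f t ≤ rlIntegral β g t := by
  unfold rlIntegral
  refine mul_le_mul_of_nonneg_left ?_ (inv_nonneg.2 (Real.Gamma_pos_of_pos hβ).le)
  refine intervalIntegral.integral_mono_on ht.1 (intervalIntegrable_sub_rpow_mul hβ hf le_rfl ht.1 ht.2)
    (intervalIntegrable_sub_rpow_mul hβ hg le_rfl ht.1 ht.2) fun s hs => ?_
  exact mul_le_mul_of_nonneg_left (h s ⟨hs.1, hs.2.trans ht.2⟩)
    (Real.rpow_nonneg (sub_nonneg.2 hs.2) _)

theorem rlIntegral_abs_le {β T t M : ℝ} (hβ : 0 < β) {f : ℝ → ℝ} (hf : ContinuousOn f (Icc 0 T))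
    (ht : t ∈ Icc 0 T) (h : ∀ s ∈ Icc 0 T, |f s| ≤ M) :
    |rlIntegral β f t| ≤ M * t ^ β / Real.Gamma (β + 1) := by
  rw [abs_le]
  constructor
  · have := rlIntegral_mono hβ continuousOn_const hf ht (fun s hs => (abs_le.1 (h s hs)).1)
    rwa [rlIntegral_const hβ, neg_mul, neg_div] at this
  · have := rlIntegral_mono hβ hf continuousOn_const ht (fun s hs => (abs_le.1 (h s hs)).2)
    rwa [rlIntegral_const hβ] at this

/-! ### Continuity of fractional integrals -/

/-- The fractional integral rescaled to the unit interval. -/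
theorem rlIntegral_eq_scaled {β t : ℝ} (hβ : 0 < β) (ht : 0 ≤ t) (f : ℝ → ℝ) :
    rlIntegral β f t =
      (Real.Gamma β)⁻¹ * (t ^ β * ∫ r in (0 : ℝ)..1, (1 - r) ^ (β - 1) * f (t * r)) := by
  unfold rlIntegral
  congr 1
  rcases ht.eq_or_lt with rfl | ht
  · simp [Real.zero_rpow hβ.ne']
  have h1 := intervalIntegral.mul_integral_comp_mul_left (a := 0) (b := 1)
    (f := fun s => (t - s) ^ (β - 1) * f s) t
  simp only [mul_zero, mul_one] at h1
  rw [← h1, ← intervalIntegral.integral_const_mul, ← intervalIntegral.integral_const_mul]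
  refine intervalIntegral.integral_congr fun r hr => ?_
  rw [uIcc_of_le zero_le_one] at hr
  have h2 : t - t * r = t * (1 - r) := by ring
  simp only [h2]
  rw [Real.mul_rpow ht.le (by linarith [hr.2]), Real.rpow_sub_one ht.ne']
  field_simp

theorem continuous_scaled_integral {β M : ℝ} (hβ : 0 < β) {f : ℝ → ℝ} (hf : Continuous f)
    (hM : ∀ s, |f s| ≤ M) :
    Continuous fun t : ℝ => ∫ r in (0 : ℝ)..1, (1 - r) ^ (β - 1) * f (t * r) := by
  refine intervalIntegral.continuous_of_dominated_interval (bound := fun r => |(1 - r) ^ (β - 1)| * M)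
    (fun t => ?_) (fun t => ?_) ?_ ?_
  · exact (intervalIntegrable_sub_rpow hβ 1 0 1).def'.aestronglyMeasurable.mul
      (by fun_prop : Continuous fun r => f (t * r)).aestronglyMeasurable
  · refine ae_of_all _ fun r _ => ?_
    rw [norm_mul, Real.norm_eq_abs, Real.norm_eq_abs]
    exact mul_le_mul_of_nonneg_left (hM _) (abs_nonneg _)
  · exact ((intervalIntegrable_sub_rpow hβ 1 0 1).abs).mul_const M
  · exact ae_of_all _ fun r _ => by fun_prop

/-- A function continuous on `[0, T]` agrees there with a bounded continuous function. -/
theorem exists_continuous_bounded_eqOn {T : ℝ} (hT : 0 ≤ T) {f : ℝ → ℝ}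
    (hf : ContinuousOn f (Icc 0 T)) :
    ∃ (g : ℝ → ℝ) (M : ℝ), Continuous g ∧ (∀ s, |g s| ≤ M) ∧ ∀ s ∈ Icc 0 T, f s = g s := by
  obtain ⟨M, hM⟩ := isCompact_Icc.exists_bound_of_continuousOn hf
  refine ⟨IccExtend hT ((Icc 0 T).domRestrict f), M, (hf.domRestrict).Icc_extend', fun s => ?_,
    fun s hs => ?_⟩
  · exact hM _ (projIcc 0 T hT s).2
  · rw [IccExtend_of_mem _ _ hs]; rfl

theorem continuousOn_rlIntegral {β T : ℝ} (hβ : 0 < β) {f : ℝ → ℝ}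
    (hf : ContinuousOn f (Icc 0 T)) : ContinuousOn (rlIntegral β f) (Icc 0 T) := by
  rcases lt_or_ge T 0 with hT | hT
  · simp [Icc_eq_empty_of_lt hT]
  obtain ⟨g, M, hg, hM, hfg⟩ := exists_continuous_bounded_eqOn hT hf
  have h1 : Continuous fun t : ℝ => (Real.Gamma β)⁻¹ *
      (t ^ β * ∫ r in (0 : ℝ)..1, (1 - r) ^ (β - 1) * g (t * r)) :=
    continuous_const.mul ((Real.continuous_rpow_const hβ.le).mul
      (continuous_scaled_integral hβ hg hM))
  refine h1.continuousOn.congr fun t ht => ?_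
  rw [rlIntegral_congr ht.1 fun s hs => hfg s ⟨hs.1, hs.2.trans ht.2⟩,
    rlIntegral_eq_scaled hβ ht.1]

/-! ### The Beta integral and the semigroup property -/

theorem hasDerivWithinAt_integral_Icc {T : ℝ} {f : ℝ → ℝ} (hf : ContinuousOn f (Icc 0 T))
    {t : ℝ} (ht : t ∈ Icc 0 T) :
    HasDerivWithinAt (fun u => ∫ s in (0 : ℝ)..u, f s) (f t) (Icc 0 T) t := by
  obtain ⟨g, M, hg, hM, hfg⟩ := exists_continuous_bounded_eqOn (ht.1.trans ht.2) hf
  have key : ∀ u ∈ Icc 0 T, ∫ s in (0 : ℝ)..u, f s = ∫ s in (0 : ℝ)..u, g s := fun u hu =>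
    intervalIntegral.integral_congr fun s hs => by
      rw [uIcc_of_le hu.1] at hs
      exact hfg s ⟨hs.1, hs.2.trans hu.2⟩
  rw [hfg t ht]
  exact (hg.integral_hasStrictDerivAt 0 t).hasDerivAt.hasDerivWithinAt.congr key (key t ht)

theorem integral_sub_rpow_mul_sub_rpow {α r t : ℝ} (h0 : 0 < α) (h1 : α < 1) (hrt : r < t) :
    ∫ s in r..t, (t - s) ^ ((1 - α) - 1) * (s - r) ^ (α - 1) =
      Real.Gamma (1 - α) * Real.Gamma α := by
  have hd : 0 < t - r := sub_pos.2 hrt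
  have e1 : ∫ s in r..t, (t - s) ^ ((1 - α) - 1) * (s - r) ^ (α - 1) =
      ∫ s in (0 : ℝ)..(t - r), (t - r - s) ^ ((1 - α) - 1) * s ^ (α - 1) := by
    rw [← sub_self r, ← intervalIntegral.integral_comp_sub_right
      (fun s => (t - r - s) ^ ((1 - α) - 1) * s ^ (α - 1)) r]
    simp
  have e2 := Complex.betaIntegral_scaled (α : ℂ) ((1 - α : ℝ) : ℂ) hd
  have e3 : ∫ x in (0 : ℝ)..(t - r), (x : ℂ) ^ ((α : ℂ) - 1) *
      (((t - r : ℝ) : ℂ) - x) ^ ((((1 - α : ℝ) : ℂ)) - 1) =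
      ((∫ s in (0 : ℝ)..(t - r), (t - r - s) ^ ((1 - α) - 1) * s ^ (α - 1) : ℝ) : ℂ) := by
    rw [← intervalIntegral.integral_ofReal]
    refine intervalIntegral.integral_congr fun x hx => ?_
    rw [uIcc_of_le hd.le] at hx
    rw [Complex.ofReal_mul, Complex.ofReal_cpow (by linarith [hx.2]), Complex.ofReal_cpow hx.1]
    push_cast
    ring
  rw [e3, Complex.betaIntegral_eq_Gamma_mul_div _ _ (by simpa using h0) (by simpa using h1),
    Complex.Gamma_ofReal, Complex.Gamma_ofReal] at e2
  rw [e1]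
  -- The two orders sum to 1, so the scaling factor is (t - r)^0 and the integral does not depend on
  -- r.
  have e4 : (α : ℂ) + ((1 - α : ℝ) : ℂ) = 1 := by push_cast; ring
  rw [e4] at e2
  simp only [sub_self, Complex.cpow_zero, Complex.Gamma_one, div_one, one_mul] at e2
  rw [mul_comm (Real.Gamma (1 - α))]
  exact_mod_cast e2

/-- The semigroup property `I^(1 - α) I^α = I^1`. -/
theorem rlIntegral_rlIntegral_one_sub {α T t : ℝ} (h0 : 0 < α) (h1 : α < 1) {f : ℝ → ℝ}
    (hf : ContinuousOn f (Icc 0 T)) (ht : t ∈ Icc 0 T) :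
    rlIntegral (1 - α) (rlIntegral α f) t = ∫ s in (0 : ℝ)..t, f s := by
  obtain ⟨g, M, hg, hM, hfg⟩ := exists_continuous_bounded_eqOn (ht.1.trans ht.2) hf
  rw [rlIntegral_congr ht.1 fun s hs => rlIntegral_congr hs.1 fun r hr =>
    hfg r ⟨hr.1, hr.2.trans (hs.2.trans ht.2)⟩]
  have hI : ∫ s in (0 : ℝ)..t, f s = ∫ s in (0 : ℝ)..t, g s := intervalIntegral.integral_congr fun s hs => by
    rw [uIcc_of_le ht.1] at hs
    exact hfg s ⟨hs.1, hs.2.trans ht.2⟩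
  rw [hI]
  -- The indicator of r < s turns the triangle into a square, so that Fubini applies; integrating k
  -- in s first leaves a constant.
  set k : ℝ → ℝ → ℝ := fun s r =>
    (Ioi r).indicator (fun s => (t - s) ^ ((1 - α) - 1) * (s - r) ^ (α - 1)) s with hk
  have hkm : Measurable (Function.uncurry k) := by
    have : Function.uncurry k = ({p : ℝ × ℝ | p.2 < p.1}).indicator
        fun p => (t - p.1) ^ ((1 - α) - 1) * (p.1 - p.2) ^ (α - 1) := by
      ext ⟨s, r⟩
      simp [k, indicator, Function.uncurry]
    rw [this]
    exact Measurable.indicator (by fun_prop) (measurableSet_lt measurable_snd measurable_fst)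
  have hG : 0 < Real.Gamma (1 - α) * Real.Gamma α :=
    mul_pos (Real.Gamma_pos_of_pos (by linarith)) (Real.Gamma_pos_of_pos h0)
  have hks : ∀ r ∈ Ioo 0 t, ∫ s in Ioc 0 t, k s r = Real.Gamma (1 - α) * Real.Gamma α := by
    intro r hr
    rw [← integral_sub_rpow_mul_sub_rpow h0 h1 hr.2, intervalIntegral.integral_of_le hr.2.le,
      setIntegral_indicator measurableSet_Ioi]
    congr 2
    ext s
    simp only [mem_inter_iff, mem_Ioc, mem_Ioi]
    constructor
    · rintro ⟨⟨_, h⟩, h'⟩; exact ⟨h', h⟩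
    · rintro ⟨h', h⟩; exact ⟨⟨hr.1.trans h', h⟩, h'⟩
  have hk0 : ∀ r, ∀ s ∈ Ioc 0 t, 0 ≤ k s r := by
    intro r s hs
    simp only [hk, indicator_apply, mem_Ioi]
    split_ifs with h
    · exact mul_nonneg (Real.rpow_nonneg (sub_nonneg.2 hs.2) _)
        (Real.rpow_nonneg (sub_nonneg.2 h.le) _)
    · exact le_rfl
  have hae : ∀ᵐ r ∂(volume.restrict (Ioc 0 t)), r ∈ Ioo 0 t := by
    rw [← Measure.restrict_congr_set Ioo_ae_eq_Ioc]
    exact ae_restrict_mem measurableSet_Ioo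
  have hkint : ∀ r ∈ Ioo 0 t, IntegrableOn (fun s => k s r) (Ioc 0 t) := fun r hr => by
    -- A non-integrable function has Bochner integral 0, so the nonzero Beta value already gives
    -- integrability.
    refine Integrable.of_integral_ne_zero ?_
    rw [hks r hr]
    exact hG.ne'
  have hint : Integrable (Function.uncurry fun s r => k s r * g r)
      ((volume.restrict (Ioc 0 t)).prod (volume.restrict (Ioc 0 t))) := by
    have hm : Measurable (Function.uncurry fun s r => k s r * g r) :=
      hkm.mul (hg.measurable.comp measurable_snd)
    rw [integrable_prod_iff' hm.aestronglyMeasurable]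
    constructor
    · filter_upwards [hae] with r hr
      exact (hkint r hr).mul_const (g r)
    · have h2 : IntegrableOn (fun r => Real.Gamma (1 - α) * Real.Gamma α * |g r|) (Ioc 0 t) :=
        (continuous_const.mul hg.abs).integrableOn_Ioc
      refine h2.congr ?_
      filter_upwards [hae] with r hr
      rw [← hks r hr, ← integral_mul_const]
      refine setIntegral_congr_fun measurableSet_Ioc fun s hs => ?_
      simp [Function.uncurry, abs_of_nonneg (hk0 r s hs)]
  have hL : ∀ s ∈ Ioc 0 t, ∫ r in Ioc 0 t, k s r * g r =
      (t - s) ^ ((1 - α) - 1) * ∫ r in (0 : ℝ)..s, (s - r) ^ (α - 1) * g r := by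
    intro s hs
    rw [← intervalIntegral.integral_const_mul, intervalIntegral.integral_of_le hs.1.le,
      integral_Ioc_eq_integral_Ioo]
    have h3 : ∀ r, k s r * g r = (Iio s).indicator
        (fun r => (t - s) ^ ((1 - α) - 1) * ((s - r) ^ (α - 1) * g r)) r := by
      intro r
      simp only [hk, indicator_apply, mem_Ioi, mem_Iio]
      split_ifs <;> ring
    simp only [h3]
    rw [setIntegral_indicator measurableSet_Iio]
    rw [integral_Ioc_eq_integral_Ioo (x := 0) (y := s)]
    congr 2
    ext r
    simp only [mem_inter_iff, mem_Ioo, mem_Iio]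
    constructor
    · rintro ⟨⟨h, _⟩, h'⟩; exact ⟨h, h'⟩
    · rintro ⟨h, h'⟩; exact ⟨⟨h, h'.trans_le hs.2⟩, h'⟩
  have hmain := integral_integral_swap hint
  have hR : ∫ r in Ioc 0 t, ∫ s in Ioc 0 t, k s r * g r =
      Real.Gamma (1 - α) * Real.Gamma α * ∫ s in (0 : ℝ)..t, g s := by
    rw [intervalIntegral.integral_of_le ht.1, ← integral_const_mul]
    refine integral_congr_ae ?_
    filter_upwards [hae] with r hr
    rw [integral_mul_const, hks r hr]
  rw [hR, setIntegral_congr_fun measurableSet_Ioc hL] at hmain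
  unfold rlIntegral
  have h4 : ∫ s in (0 : ℝ)..t, (t - s) ^ ((1 - α) - 1) *
      ((Real.Gamma α)⁻¹ * ∫ r in (0 : ℝ)..s, (s - r) ^ (α - 1) * g r) =
      (Real.Gamma α)⁻¹ * ∫ s in Ioc 0 t, (t - s) ^ ((1 - α) - 1) *
        ∫ r in (0 : ℝ)..s, (s - r) ^ (α - 1) * g r := by
    rw [intervalIntegral.integral_of_le ht.1, ← integral_const_mul]
    congr 1
    ext s
    ring
  rw [h4, hmain]
  have := (Real.Gamma_pos_of_pos h0).ne'
  have := (Real.Gamma_pos_of_pos (sub_pos.2 h1)).ne'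
  field_simp

/-! ### The maximum principle -/

/-- This is u ≤ u^α for u = s / t in [0, 1], multiplied by t^α. -/
theorem rpow_sub_rpow_le {α s t : ℝ} (h1 : α < 1) (hs : 0 ≤ s) (hst : s ≤ t) (ht : 0 < t) :
    t ^ α - s ^ α ≤ t ^ α / t * (t - s) := by
  have hu0 : 0 ≤ s / t := by positivity
  have hu1 : s / t ≤ 1 := (div_le_one ht).2 hst
  have h2 : s / t ≤ (s / t) ^ α := by
    rcases hu0.eq_or_lt with h | h
    · rw [← h]; exact Real.rpow_nonneg le_rfl _
    · simpa using Real.rpow_le_rpow_of_exponent_ge h hu1 h1.le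
  rw [Real.div_rpow hs ht.le, le_div_iff₀ (Real.rpow_pos_of_pos ht α)] at h2
  have h3 : t ^ α / t * (t - s) = t ^ α - s / t * t ^ α := by field_simp
  linarith

/-- After rescaling, Γ(α) I^α f(t) = t^α G(t), where G inherits a Lipschitz bound from f. The factor
t^α is Lipschitz only away from 0, so K depends on the fixed endpoint t. -/
theorem exists_abs_rlIntegral_sub_le {α T t L : ℝ} (h0 : 0 < α) (h1 : α < 1) {f : ℝ → ℝ}
    (hf : ContinuousOn f (Icc 0 T))
    (hL : ∀ s ∈ Icc 0 T, ∀ r ∈ Icc 0 T, |f s - f r| ≤ L * |s - r|)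
    (ht0 : 0 < t) (htT : t ≤ T) :
    ∃ K, ∀ s ∈ Icc 0 t, |rlIntegral α f t - rlIntegral α f s| ≤ K * (t - s) := by
  set G : ℝ → ℝ := fun t => ∫ r in (0 : ℝ)..1, (1 - r) ^ (α - 1) * f (t * r) with hG
  have hmem : ∀ s ∈ Icc 0 t, ∀ r ∈ Icc (0 : ℝ) 1, s * r ∈ Icc 0 T := fun s hs r hr =>
    ⟨mul_nonneg hs.1 hr.1, (mul_le_of_le_one_right hs.1 hr.2).trans (hs.2.trans htT)⟩
  have hGint : ∀ s ∈ Icc 0 t,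
      IntervalIntegrable (fun r => (1 - r) ^ (α - 1) * f (s * r)) volume 0 1 := fun s hs => by
    refine intervalIntegrable_sub_rpow_mul (T := 1) h0 ?_ le_rfl zero_le_one le_rfl
    exact hf.comp (by fun_prop) (hmem s hs)
  have hG' : ∀ s ∈ Icc 0 t, |G t - G s| ≤ L * (t - s) * (1 / α) := by
    intro s hs
    have e : G t - G s = ∫ r in (0 : ℝ)..1, (1 - r) ^ (α - 1) * (f (t * r) - f (s * r)) := by
      rw [hG]
      simp only [mul_sub]
      rw [intervalIntegral.integral_sub (hGint t ⟨ht0.le, le_rfl⟩) (hGint s hs)]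
    have e2 : L * (t - s) * (1 / α) =
        ∫ r in (0 : ℝ)..1, (1 - r) ^ (α - 1) * (L * (t - s)) := by
      rw [intervalIntegral.integral_mul_const, integral_sub_rpow h0]
      simp; ring
    rw [e, e2, ← Real.norm_eq_abs]
    refine intervalIntegral.norm_integral_le_of_norm_le zero_le_one (ae_of_all _ fun r hr => ?_)
      ((intervalIntegrable_sub_rpow h0 1 0 1).mul_const _)
    rw [norm_mul, Real.norm_eq_abs, Real.norm_eq_abs,
      abs_of_nonneg (Real.rpow_nonneg (sub_nonneg.2 hr.2) _)]
    refine mul_le_mul_of_nonneg_left ?_ (Real.rpow_nonneg (sub_nonneg.2 hr.2) _)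
    have hr' : r ∈ Icc (0 : ℝ) 1 := ⟨hr.1.le, hr.2⟩
    refine (hL _ (hmem t ⟨ht0.le, le_rfl⟩ r hr') _ (hmem s hs r hr')).trans ?_
    have hL0 : 0 ≤ L := by
      have := (abs_nonneg _).trans (hL 0 ⟨le_rfl, ht0.le.trans htT⟩ t ⟨ht0.le, htT⟩)
      rw [zero_sub, abs_neg, abs_of_pos ht0] at this
      exact nonneg_of_mul_nonneg_left this ht0
    refine mul_le_mul_of_nonneg_left ?_ hL0
    rw [← sub_mul, abs_mul, abs_of_nonneg (sub_nonneg.2 hs.2), abs_of_pos hr.1]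
    exact mul_le_of_le_one_right (sub_nonneg.2 hs.2) hr.2
  have hΓ := inv_pos.2 (Real.Gamma_pos_of_pos h0)
  refine ⟨(Real.Gamma α)⁻¹ * (t ^ α / t * |G t| + t ^ α * (L * (1 / α))), fun s hs => ?_⟩
  rw [rlIntegral_eq_scaled h0 ht0.le, rlIntegral_eq_scaled h0 hs.1, ← mul_sub, abs_mul,
    abs_of_pos hΓ, mul_assoc]
  refine mul_le_mul_of_nonneg_left ?_ hΓ.le
  have e : t ^ α * G t - s ^ α * G s = (t ^ α - s ^ α) * G t + s ^ α * (G t - G s) := by ring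
  change |t ^ α * G t - s ^ α * G s| ≤ _
  have hm : s ^ α ≤ t ^ α := Real.rpow_le_rpow hs.1 hs.2 h0.le
  have hs0 : 0 ≤ s ^ α := Real.rpow_nonneg hs.1 _
  calc |t ^ α * G t - s ^ α * G s| ≤ |(t ^ α - s ^ α) * G t| + |s ^ α * (G t - G s)| := by
        rw [e]; exact abs_add_le _ _
    _ ≤ t ^ α / t * (t - s) * |G t| + t ^ α * (L * (t - s) * (1 / α)) := by
        rw [abs_mul, abs_mul, abs_of_nonneg (sub_nonneg.2 hm), abs_of_nonneg hs0]
        refine add_le_add ?_ ?_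
        · exact mul_le_mul_of_nonneg_right (rpow_sub_rpow_le h1 hs.1 hs.2 ht0) (abs_nonneg _)
        · exact mul_le_mul hm (hG' s hs) (abs_nonneg _) (hs0.trans hm)
    _ = _ := by ring

/-- On [0, t - h] the kernel only grows when t is replaced by t - h, since γ - 1 ≤ 0. On [t - h, t]
the linear vanishing of z gives z ≤ K h, so the error is of order h^(1 + γ), which is o(h). -/
theorem rlIntegral_le_of_vanishing {γ T t h K : ℝ} (h0 : 0 < γ) (h1 : γ ≤ 1) {z : ℝ → ℝ}
    (hz : ContinuousOn z (Icc 0 T)) (htT : t ≤ T) (hh : 0 ≤ h) (hht : h ≤ t)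
    (hz0 : ∀ s ∈ Icc 0 t, 0 ≤ z s) (hzK : ∀ s ∈ Icc 0 t, z s ≤ K * (t - s)) :
    rlIntegral γ z t ≤ rlIntegral γ z (t - h) + K * h * h ^ γ / Real.Gamma (γ + 1) := by
  have hΓ := Real.Gamma_pos_of_pos h0
  have hi1 : IntervalIntegrable (fun s => (t - s) ^ (γ - 1) * z s) volume 0 (t - h) :=
    intervalIntegrable_sub_rpow_mul h0 hz le_rfl (by linarith) (by linarith)
  have hi2 : IntervalIntegrable (fun s => (t - s) ^ (γ - 1) * z s) volume (t - h) t :=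
    intervalIntegrable_sub_rpow_mul h0 hz (by linarith) (by linarith) (by linarith)
  have hi3 : IntervalIntegrable (fun s => (t - h - s) ^ (γ - 1) * z s) volume 0 (t - h) :=
    intervalIntegrable_sub_rpow_mul h0 hz le_rfl (by linarith) (by linarith)
  have a1 : ∫ s in (0 : ℝ)..(t - h), (t - s) ^ (γ - 1) * z s ≤
      ∫ s in (0 : ℝ)..(t - h), (t - h - s) ^ (γ - 1) * z s := by
    -- The endpoint s = t - h must be left out: for γ < 1 the right kernel there is 0^(γ - 1) = 0 by
    -- convention.
    refine intervalIntegral.integral_mono_on_of_le_Ioo (by linarith) hi1 hi3 fun s hs => ?_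
    refine mul_le_mul_of_nonneg_right ?_ (hz0 s ⟨hs.1.le, by linarith [hs.2]⟩)
    exact Real.rpow_le_rpow_of_nonpos (by linarith [hs.2]) (by linarith) (by linarith)
  have a2 : ∫ s in (t - h)..t, (t - s) ^ (γ - 1) * z s ≤ h ^ γ / γ * (K * h) := by
    have e : h ^ γ / γ * (K * h) = ∫ s in (t - h)..t, (t - s) ^ (γ - 1) * (K * h) := by
      rw [intervalIntegral.integral_mul_const, integral_sub_rpow h0]
      simp
    rw [e]
    refine intervalIntegral.integral_mono_on (by linarith) hi2
      ((intervalIntegrable_sub_rpow h0 t _ _).mul_const _) fun s hs => ?_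
    refine mul_le_mul_of_nonneg_left ?_ (Real.rpow_nonneg (sub_nonneg.2 hs.2) _)
    -- The sign of K is not given: for h > 0 it follows from 0 ≤ z (t - h) ≤ K h, and for h = 0 only
    -- s = t remains.
    rcases hh.eq_or_lt with rfl | hh'
    · have : s = t := by linarith [hs.1, hs.2]
      subst this
      simpa using hzK s ⟨by linarith, le_rfl⟩
    · have hK : 0 ≤ K := by
        have h3 := (hz0 (t - h) ⟨by linarith, by linarith⟩).trans
          (hzK (t - h) ⟨by linarith, by linarith⟩)
        rw [sub_sub_cancel] at h3
        exact nonneg_of_mul_nonneg_left h3 hh'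
      exact (hzK s ⟨by linarith [hs.1], hs.2⟩).trans
        (mul_le_mul_of_nonneg_left (by linarith [hs.1]) hK)
  unfold rlIntegral
  rw [← intervalIntegral.integral_add_adjacent_intervals hi1 hi2]
  have e : K * h * h ^ γ / Real.Gamma (γ + 1) = (Real.Gamma γ)⁻¹ * (h ^ γ / γ * (K * h)) := by
    rw [Real.Gamma_add_one h0.ne']
    field_simp
  rw [e, ← mul_add]
  exact mul_le_mul_of_nonneg_left (add_le_add a1 a2) (inv_nonneg.2 hΓ.le)

/-- Positive maximum principle for the inverse of the fractional integral. -/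
theorem nonneg_of_isMaxOn_rlIntegral {α T t L : ℝ} (h0 : 0 < α) (h1 : α < 1) {f : ℝ → ℝ}
    (hf : ContinuousOn f (Icc 0 T))
    (hL : ∀ s ∈ Icc 0 T, ∀ r ∈ Icc 0 T, |f s - f r| ≤ L * |s - r|)
    (ht : t ∈ Icc 0 T) (hmax : IsMaxOn (rlIntegral α f) (Icc 0 T) t)
    (hpos : 0 < rlIntegral α f t) : 0 ≤ f t := by
  have ht0 : 0 < t := by
    refine ht.1.lt_of_ne ?_
    rintro rfl
    simp [rlIntegral_zero_right] at hpos
  have hγ : 0 < 1 - α := by linarith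
  obtain ⟨K, hK⟩ := exists_abs_rlIntegral_sub_le h0 h1 hf hL ht0 ht.2
  set x := rlIntegral α f with hx
  have hxc : ContinuousOn x (Icc 0 T) := continuousOn_rlIntegral h0 hf
  set y := fun t => ∫ s in (0 : ℝ)..t, f s with hy
  have hxy : ∀ s ∈ Icc 0 T, rlIntegral (1 - α) x s = y s := fun s hs =>
    rlIntegral_rlIntegral_one_sub h0 h1 hf hs
  have hzc : ContinuousOn (fun s => x t - x s) (Icc 0 T) := continuousOn_const.sub hxc
  -- For z = x t - x ≥ 0, I^(1 - α) z at s is x t * s^(1 - α) / Γ(2 - α) - y s. Comparing its values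
  -- at t and s bounds the left difference quotients of y, whose limit is f t, from below by a
  -- quantity tending to 0.
  have hstep : ∀ s ∈ Ioo 0 t,
      -(K / Real.Gamma (1 - α + 1) * (t - s) ^ (1 - α)) ≤ slope y t s := by
    intro s hs
    have hsT : s ∈ Icc 0 T := ⟨hs.1.le, hs.2.le.trans ht.2⟩
    have key := rlIntegral_le_of_vanishing (h := t - s) (K := K) hγ (by linarith) hzc ht.2
      (by linarith [hs.2]) (by linarith [hs.1])
      (fun r hr => sub_nonneg.2 (hmax ⟨hr.1, hr.2.trans ht.2⟩))
      (fun r hr => (le_abs_self _).trans (hK r hr))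
    rw [sub_sub_cancel, rlIntegral_sub hγ continuousOn_const hxc ht,
      rlIntegral_sub hγ continuousOn_const hxc hsT, rlIntegral_const hγ, rlIntegral_const hγ,
      hxy t ht, hxy s hsT] at key
    have hG : 0 < Real.Gamma (1 - α + 1) := Real.Gamma_pos_of_pos (by linarith)
    -- Positivity of the maximum enters here.
    have hc : x t * s ^ (1 - α) / Real.Gamma (1 - α + 1) ≤
        x t * t ^ (1 - α) / Real.Gamma (1 - α + 1) := by
      have := Real.rpow_le_rpow hs.1.le hs.2.le hγ.le
      gcongr
    have hts : 0 < t - s := sub_pos.2 hs.2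
    have e : slope y t s = (y t - y s) / (t - s) := by
      rw [slope_comm, slope_def_field]
    rw [e, le_div_iff₀ hts]
    have e2 : -(K / Real.Gamma (1 - α + 1) * (t - s) ^ (1 - α)) * (t - s) =
      -(K * (t - s) * (t - s) ^ (1 - α) / Real.Gamma (1 - α + 1)) := by ring
    rw [e2]
    linarith
  have hd : HasDerivWithinAt y (f t) (Ioo 0 t) t :=
    (hasDerivWithinAt_integral_Icc hf ht).mono fun s hs => ⟨hs.1.le, hs.2.le.trans ht.2⟩
  have hlim := (hasDerivWithinAt_iff_tendsto_slope' (by simp)).1 hd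
  have hlim0 : Tendsto (fun s => -(K / Real.Gamma (1 - α + 1) * (t - s) ^ (1 - α)))
      (𝓝[Ioo 0 t] t) (𝓝 0) := by
    have : Continuous fun s => -(K / Real.Gamma (1 - α + 1) * (t - s) ^ (1 - α)) :=
      (continuous_const.mul ((Real.continuous_rpow_const hγ.le).comp
        (continuous_const.sub continuous_id))).neg
    have h2 := (this.tendsto t).mono_left (nhdsWithin_le_nhds (s := Ioo 0 t))
    simpa [Real.zero_rpow hγ.ne'] using h2
  have : (𝓝[Ioo 0 t] t).NeBot := by
    rw [nhdsWithin_Ioo_eq_nhdsLT ht0]; infer_instance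
  exact le_of_tendsto_of_tendsto hlim0 hlim
    (eventually_nhdsWithin_of_forall hstep)

/-! ### A priori bound uniform in lam -/

/-- If the bound fails, I^α(f - C) has a positive maximum, at t₀ say. There f ≥ C by the maximum
principle and I^α f > 0, so lam I^α f + f > C, a contradiction. -/
theorem rlIntegral_le_of_lipschitz {α T L lam C : ℝ} (h0 : 0 < α) (h1 : α < 1) (hlam : 0 < lam)
    {f : ℝ → ℝ} (hf : ContinuousOn f (Icc 0 T))
    (hL : ∀ s ∈ Icc 0 T, ∀ r ∈ Icc 0 T, |f s - f r| ≤ L * |s - r|) (hC : 0 ≤ C)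
    (hle : ∀ t ∈ Icc 0 T, lam * rlIntegral α f t + f t ≤ C) :
    ∀ t ∈ Icc 0 T, rlIntegral α f t ≤ C * t ^ α / Real.Gamma (α + 1) := by
  intro t ht
  have hw : ∀ s ∈ Icc 0 T, rlIntegral α (fun r => f r - C) s =
      rlIntegral α f s - C * s ^ α / Real.Gamma (α + 1) := fun s hs => by
    rw [rlIntegral_sub h0 hf continuousOn_const hs, rlIntegral_const h0]
  have hwc : ContinuousOn (fun r => f r - C) (Icc 0 T) := hf.sub continuousOn_const
  obtain ⟨t₀, ht₀, hmax⟩ := isCompact_Icc.exists_isMaxOn ⟨t, ht⟩ (continuousOn_rlIntegral h0 hwc)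
  by_contra! hlt
  have hpos : 0 < rlIntegral α (fun r => f r - C) t₀ :=
    lt_of_lt_of_le (by rw [hw t ht]; linarith) (hmax ht)
  have hnn := nonneg_of_isMaxOn_rlIntegral h0 h1 hwc (L := L)
    (fun s hs r hr => by simpa using hL s hs r hr) ht₀ hmax hpos
  rw [hw t₀ ht₀] at hpos
  have h3 : 0 ≤ C * t₀ ^ α / Real.Gamma (α + 1) :=
    div_nonneg (mul_nonneg hC (Real.rpow_nonneg ht₀.1 _))
      (Real.Gamma_pos_of_pos (by linarith)).le
  have h4 : 0 < lam * rlIntegral α f t₀ := mul_pos hlam (by linarith)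
  linarith [hle t₀ ht₀]

theorem rlIntegral_le_of_add_le {α T lam C : ℝ} (h0 : 0 < α) (h1 : α < 1) (hlam : 0 < lam)
    {f : ℝ → ℝ} (hf : ContinuousOn f (Icc 0 T)) (hC : 0 ≤ C)
    (hle : ∀ t ∈ Icc 0 T, lam * rlIntegral α f t + f t ≤ C) :
    ∀ t ∈ Icc 0 T, rlIntegral α f t ≤ C * t ^ α / Real.Gamma (α + 1) := by
  intro t ht
  have hG : 0 < Real.Gamma (α + 1) := Real.Gamma_pos_of_pos (by linarith)
  set K := T ^ α / Real.Gamma (α + 1) with hKdef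
  have hK : 0 ≤ K := div_nonneg (Real.rpow_nonneg (ht.1.trans ht.2) _) hG.le
  -- A polynomial p within ε of f has I^α p within ε K of I^α f, so lam I^α p + p exceeds C by at
  -- most ε (1 + lam K); the last ε K is the cost of returning to f.
  have key : ∀ ε > 0, rlIntegral α f t ≤
      (C + ε * (1 + lam * K)) * t ^ α / Real.Gamma (α + 1) + ε * K := by
    intro ε hε
    obtain ⟨p, hp⟩ := exists_polynomial_near_of_continuousOn 0 T f hf ε hε
    have hpc : ContinuousOn (fun s => p.eval s) (Icc 0 T) := p.continuous.continuousOn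
    obtain ⟨L, hL⟩ := (p.contDiff_aeval (𝕜 := ℝ) 1).locallyLipschitz.locallyLipschitzOn
      |>.exists_lipschitzOnWith_of_compact (isCompact_Icc (a := (0 : ℝ)) (b := T))
    have hclose : ∀ s ∈ Icc 0 T,
        |rlIntegral α (fun s => p.eval s) s - rlIntegral α f s| ≤ ε * K := fun s hs => by
      rw [← rlIntegral_sub h0 hpc hf hs]
      refine (rlIntegral_abs_le h0 (hpc.sub hf) hs fun r hr => (hp r hr).le).trans ?_
      rw [hKdef, ← mul_div_assoc]
      have := Real.rpow_le_rpow hs.1 hs.2 h0.le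
      gcongr
    have h2 := rlIntegral_le_of_lipschitz (C := C + ε * (1 + lam * K)) h0 h1 hlam hpc (L := L)
      (fun s hs r hr => by
        have := hL.dist_le_mul s hs r hr
        rwa [Real.dist_eq, Real.dist_eq] at this) (by positivity) (fun s hs => by
        have a := (abs_le.1 (hclose s hs)).2
        have b := (abs_lt.1 (hp s hs)).2
        have c := hle s hs
        nlinarith [mul_le_mul_of_nonneg_left a hlam.le]) t ht
    linarith [(abs_le.1 (hclose t ht)).1]
  have hlim : Tendsto (fun ε : ℝ => (C + ε * (1 + lam * K)) * t ^ α / Real.Gamma (α + 1) + ε * K)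
      (𝓝[>] 0) (𝓝 (C * t ^ α / Real.Gamma (α + 1))) := by
    have hc : Continuous fun ε : ℝ =>
      (C + ε * (1 + lam * K)) * t ^ α / Real.Gamma (α + 1) + ε * K := by fun_prop
    simpa using (hc.tendsto 0).mono_left (nhdsWithin_le_nhds (s := Ioi 0))
  exact ge_of_tendsto hlim (eventually_nhdsWithin_of_forall key)

/-- A priori bound for the linear equation `D^α x + lam x = h`, `x 0 = 0`, in integrated form. -/
theorem abs_rlIntegral_le_of_abs_add_le {α T lam C : ℝ} (h0 : 0 < α) (h1 : α < 1)
    (hlam : 0 ≤ lam) {f : ℝ → ℝ} (hf : ContinuousOn f (Icc 0 T))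
    (hle : ∀ t ∈ Icc 0 T, |lam * rlIntegral α f t + f t| ≤ C) :
    ∀ t ∈ Icc 0 T, |rlIntegral α f t| ≤ C * t ^ α / Real.Gamma (α + 1) := by
  intro t ht
  have hC : 0 ≤ C := (abs_nonneg _).trans (hle t ht)
  -- The value lam = 0, where continuation starts, is outside the maximum principle argument, but
  -- there the bound is the trivial one for I^α.
  rcases hlam.eq_or_lt with rfl | hlam
  · exact rlIntegral_abs_le h0 hf ht fun s hs => by simpa using hle s hs
  have hneg : ∀ s, rlIntegral α (fun r => -f r) s = -rlIntegral α f s := fun s => by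
    simp [rlIntegral]
  rw [abs_le']
  refine ⟨rlIntegral_le_of_add_le h0 h1 hlam hf hC (fun s hs => (abs_le'.1 (hle s hs)).1) t ht, ?_⟩
  rw [← hneg]
  refine rlIntegral_le_of_add_le h0 h1 hlam (f := fun r => -f r) hf.neg hC (fun s hs => ?_) t ht
  rw [hneg]
  linarith [(abs_le'.1 (hle s hs)).2]

/-! ### Evaluation and the operator I^α on C[0, T] -/

theorem evalOn_of_mem {a b : ℝ} (x : C(Icc a b, ℝ)) {t : ℝ} (ht : t ∈ Icc a b) :
    evalOn x t = x ⟨t, ht⟩ := by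
  simp only [evalOn, dif_pos ht]

theorem evalOn_coe {a b : ℝ} (x : C(Icc a b, ℝ)) (t : Icc a b) : evalOn x t = x t :=
  evalOn_of_mem x t.2

theorem continuousOn_evalOn {a b : ℝ} (x : C(Icc a b, ℝ)) : ContinuousOn (evalOn x) (Icc a b) := by
  rw [continuousOn_iff_continuous_domRestrict]
  convert x.continuous using 1
  ext t
  exact evalOn_coe x t

theorem evalOn_restrictNonneg {v T t : ℝ} (hv : 0 < v) (x : C(Icc (-v) T, ℝ)) (ht : t ∈ Icc 0 T) :
    evalOn (restrictNonneg hv x) t = evalOn x t := by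
  rw [evalOn_of_mem _ ht, evalOn_of_mem x ⟨by linarith [ht.1], ht.2⟩]
  rfl

/-- The fractional integral as an operator on `C[0, T]`. -/
noncomputable def rlOperator {α : ℝ} (h0 : 0 < α) {T : ℝ} (f : C(Icc (0 : ℝ) T, ℝ)) :
    C(Icc (0 : ℝ) T, ℝ) where
  toFun t := rlIntegral α (evalOn f) t
  continuous_toFun :=
    (continuousOn_rlIntegral h0 (continuousOn_evalOn f)).domRestrict

/-! ### The linear equation -/

theorem norm_sub_le_of_linear_equation {α T lam : ℝ} (h0 : 0 < α) (h1 : α < 1) (hlam : 0 ≤ lam)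
    (hT : 0 ≤ T) {h k x y : C(Icc (0 : ℝ) T, ℝ)} (hx : x = rlOperator h0 (h - lam • x))
    (hy : y = rlOperator h0 (k - lam • y)) :
    ‖x - y‖ ≤ T ^ α / Real.Gamma (α + 1) * ‖h - k‖ := by
  have hG : 0 < Real.Gamma (α + 1) := Real.Gamma_pos_of_pos (by linarith)
  have hTα : 0 ≤ T ^ α := Real.rpow_nonneg hT _
  refine (ContinuousMap.norm_le _ (by positivity)).2 fun t => ?_
  have hf1 := continuousOn_evalOn (h - lam • x)
  have hf2 := continuousOn_evalOn (k - lam • y)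
  have hxy : ∀ s (hs : s ∈ Icc 0 T),
      rlIntegral α (fun s => evalOn (h - lam • x) s - evalOn (k - lam • y) s) s =
        x ⟨s, hs⟩ - y ⟨s, hs⟩ := fun s hs => by
    rw [rlIntegral_sub h0 hf1 hf2 hs]
    exact (congrArg₂ (· - ·) (DFunLike.congr_fun hx ⟨s, hs⟩) (DFunLike.congr_fun hy ⟨s, hs⟩)).symm
  have key := abs_rlIntegral_le_of_abs_add_le (C := ‖h - k‖) h0 h1 hlam (hf1.sub hf2)
    (fun s hs => by
      change |lam * rlIntegral α (fun s => evalOn (h - lam • x) s - evalOn (k - lam • y) s) s +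
        (evalOn (h - lam • x) s - evalOn (k - lam • y) s)| ≤ _
      rw [hxy s hs, evalOn_of_mem _ hs, evalOn_of_mem _ hs]
      have := (h - k).norm_coe_le_norm ⟨s, hs⟩
      rw [Real.norm_eq_abs] at this
      convert this using 2
      simp only [ContinuousMap.coe_sub, ContinuousMap.coe_smul, Pi.sub_apply, Pi.smul_apply,
        smul_eq_mul]
      ring) t t.2
  change |rlIntegral α (fun s => evalOn (h - lam • x) s - evalOn (k - lam • y) s) t| ≤ _ at key
  rw [hxy t t.2] at key
  refine key.trans ?_
  rw [mul_div_assoc, mul_comm]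
  have := Real.rpow_le_rpow t.2.1 t.2.2 h0.le
  gcongr

theorem exists_fixed_point_of_norm_sub_le {E : Type*} [NormedAddCommGroup E] [CompleteSpace E]
    {q : ℝ} (hq0 : 0 ≤ q) (hq : q < 1) (F : E → E) (hF : ∀ x y, ‖F x - F y‖ ≤ q * ‖x - y‖) :
    ∃ x, F x = x := by
  have hc : ContractingWith (⟨q, hq0⟩ : NNReal) F :=
    ⟨by exact_mod_cast hq, LipschitzWith.of_dist_le_mul fun x y => by
      rw [dist_eq_norm, dist_eq_norm]; exact hF x y⟩
  exact ⟨hc.fixedPoint F, hc.fixedPoint_isFixedPt⟩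

/-- With R the solution operator for lam, the equation for lam + δ reads x = R(h - δ x), a
contraction with constant δ T^α / Γ(α + 1). The admissible δ does not depend on lam. -/
theorem exists_linear_equation_add {α T lam δ : ℝ} (h0 : 0 < α) (h1 : α < 1) (hlam : 0 ≤ lam)
    (hT : 0 ≤ T) (hδ : 0 ≤ δ) (hδK : δ * (T ^ α / Real.Gamma (α + 1)) < 1)
    (hex : ∀ h : C(Icc (0 : ℝ) T, ℝ), ∃ x, x = rlOperator h0 (h - lam • x))
    (h : C(Icc (0 : ℝ) T, ℝ)) : ∃ x, x = rlOperator h0 (h - (lam + δ) • x) := by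
  have hG : 0 < Real.Gamma (α + 1) := Real.Gamma_pos_of_pos (by linarith)
  have hTα : 0 ≤ T ^ α := Real.rpow_nonneg hT _
  choose R hR using hex
  obtain ⟨x, hx⟩ := exists_fixed_point_of_norm_sub_le (by positivity) hδK
    (fun x => R (h - δ • x)) fun x y => by
      refine (norm_sub_le_of_linear_equation h0 h1 hlam hT (hR _) (hR _)).trans_eq ?_
      rw [sub_sub_sub_cancel_left, ← smul_sub, norm_smul, Real.norm_of_nonneg hδ,
        norm_sub_rev]
      ring
  refine ⟨x, ?_⟩
  have := hR (h - δ • x)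
  rw [hx] at this
  rwa [add_smul, add_comm (lam • x), ← sub_sub]

/-- The linear equation `D^α x + lam x = h`, `x 0 = 0`, in integrated form, is solvable. -/
theorem exists_linear_equation {α T lam : ℝ} (h0 : 0 < α) (h1 : α < 1) (hlam : 0 ≤ lam)
    (hT : 0 ≤ T) (h : C(Icc (0 : ℝ) T, ℝ)) : ∃ x, x = rlOperator h0 (h - lam • x) := by
  -- With m this large, lam is reached from 0 in m steps of admissible length lam / m.
  obtain ⟨m, hm⟩ := exists_nat_gt (lam * (T ^ α / Real.Gamma (α + 1)))
  have hG : 0 < Real.Gamma (α + 1) := Real.Gamma_pos_of_pos (by linarith)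
  have hTα : 0 ≤ T ^ α := Real.rpow_nonneg hT _
  have hm0 : (0 : ℝ) < m := lt_of_le_of_lt (by positivity) hm
  have hδ : 0 ≤ lam / m := by positivity
  have step : ∀ k : ℕ, ∀ h : C(Icc (0 : ℝ) T, ℝ),
      ∃ x, x = rlOperator h0 (h - (k * (lam / m)) • x) := by
    intro k
    induction k with
    | zero => exact fun h => ⟨rlOperator h0 h, by simp⟩
    | succ k ih =>
      intro h
      rw [Nat.cast_succ, add_one_mul]
      refine exists_linear_equation_add h0 h1 (by positivity) hT hδ ?_ ih h
      rw [div_mul_eq_mul_div]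
      exact (div_lt_one hm0).2 hm
  have := step m h
  rwa [mul_div_cancel₀ _ hm0.ne'] at this

/-! ### The delay term -/

theorem sub_delay_mem {T v s t : ℝ} (hs : 0 ≤ s) (hsv : s ≤ v) (ht : t ∈ Icc 0 T) :
    t - s ∈ Icc (-v) T :=
  ⟨by linarith [ht.1], by linarith [ht.2]⟩

/-- The right-hand side of the delay problem, as a continuous function on `[0, T]`. -/
noncomputable def delayTerm {n : ℕ} {v T : ℝ} (τ : Fin n → ℝ) (hτ : ∀ j, 0 ≤ τ j)
    (hτv : ∀ j, τ j ≤ v) (b : Fin n → C(Icc (0 : ℝ) T, ℝ))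
    (g : Fin n → C(Icc (-v) T, ℝ) → C(Icc (-v) T, ℝ)) (x : C(Icc (-v) T, ℝ)) :
    C(Icc (0 : ℝ) T, ℝ) :=
  ∑ j, b j * (g j x).comp
    ⟨fun t : Icc (0 : ℝ) T => ⟨t - τ j, sub_delay_mem (hτ j) (hτv j) t.2⟩, by fun_prop⟩

theorem delayTerm_apply {n : ℕ} {v T : ℝ} (τ : Fin n → ℝ) (hτ : ∀ j, 0 ≤ τ j)
    (hτv : ∀ j, τ j ≤ v) (b : Fin n → C(Icc (0 : ℝ) T, ℝ))
    (g : Fin n → C(Icc (-v) T, ℝ) → C(Icc (-v) T, ℝ)) (x : C(Icc (-v) T, ℝ)) (t : Icc (0 : ℝ) T) :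
    delayTerm τ hτ hτv b g x t = ∑ j, evalOn (b j) t * evalOn (g j x) (t - τ j) := by
  simp only [delayTerm, ContinuousMap.sum_apply]
  refine Finset.sum_congr rfl fun j _ => ?_
  rw [evalOn_coe, evalOn_of_mem _ (sub_delay_mem (hτ j) (hτv j) t.2)]
  rfl

theorem norm_delayTerm_sub_le {n : ℕ} {v T : ℝ} (τ : Fin n → ℝ) (hτ : ∀ j, 0 ≤ τ j)
    (hτv : ∀ j, τ j ≤ v) (b : Fin n → C(Icc (0 : ℝ) T, ℝ))
    (g : Fin n → C(Icc (-v) T, ℝ) → C(Icc (-v) T, ℝ)) {l : Fin n → ℝ}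
    (hg : ∀ j x y, ‖g j x - g j y‖ ≤ l j * ‖x - y‖) (x y : C(Icc (-v) T, ℝ)) :
    ‖delayTerm τ hτ hτv b g x - delayTerm τ hτ hτv b g y‖ ≤ (∑ j, ‖b j‖ * l j) * ‖x - y‖ := by
  simp only [delayTerm]
  rw [← Finset.sum_sub_distrib, Finset.sum_mul]
  refine norm_sum_le_of_le _ fun j _ => ?_
  rw [← mul_sub, mul_assoc]
  refine (norm_mul_le _ _).trans (mul_le_mul_of_nonneg_left ?_ (norm_nonneg _))
  refine le_trans ?_ (hg j x y)
  exact (ContinuousMap.norm_le _ (norm_nonneg _)).2 fun t => (g j x - g j y).norm_coe_le_norm _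

/-! ### The Caputo problem as an integral equation -/

/-- Applying I^(1 - γ) makes the ordinary primitives equal; differentiation then recovers the
functions. -/
theorem eqOn_of_rlIntegral_eq {γ T : ℝ} (h0 : 0 < γ) (h1 : γ < 1) (hT : 0 < T) {f g : ℝ → ℝ}
    (hf : ContinuousOn f (Icc 0 T)) (hg : ContinuousOn g (Icc 0 T))
    (h : ∀ t ∈ Icc 0 T, rlIntegral γ f t = rlIntegral γ g t) : EqOn f g (Icc 0 T) := by
  intro t ht
  have e : ∀ u ∈ Icc 0 T, ∫ s in (0 : ℝ)..u, f s = ∫ s in (0 : ℝ)..u, g s := fun u hu => by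
    rw [← rlIntegral_rlIntegral_one_sub h0 h1 hf hu, ← rlIntegral_rlIntegral_one_sub h0 h1 hg hu]
    exact rlIntegral_congr hu.1 fun s hs => h s ⟨hs.1, hs.2.trans hu.2⟩
  have d1 := hasDerivWithinAt_integral_Icc hf ht
  have d2 := (hasDerivWithinAt_integral_Icc hg ht).congr e (e t ht)
  exact (uniqueDiffOn_Icc hT t ht).eq_deriv _ d1 d2

/-- Continuous functions vanishing at `0` have Caputo derivative `f` iff they equal `I^α f`. -/
theorem hasCaputoDerivAt_iff_eq_rlIntegral {α T : ℝ} (h0 : 0 < α) (h1 : α < 1) (hT : 0 < T)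
    {x f : ℝ → ℝ} (hx : ContinuousOn x (Icc 0 T)) (hf : ContinuousOn f (Icc 0 T)) (hx0 : x 0 = 0) :
    (∀ t ∈ Icc 0 T, HasCaputoDerivAt α T x (f t) t) ↔ ∀ t ∈ Icc 0 T, x t = rlIntegral α f t := by
  have hγ0 : 0 < 1 - α := by linarith
  simp only [HasCaputoDerivAt, hx0, sub_zero]
  constructor
  · intro h
    refine eqOn_of_rlIntegral_eq hγ0 (by linarith) hT hx (continuousOn_rlIntegral h0 hf)
      fun t ht => ?_
    rw [rlIntegral_rlIntegral_one_sub h0 h1 hf ht]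
    -- I^(1 - α) x and ∫ f have the same derivative and both vanish at 0, so they agree; injectivity
    -- of I^(1 - α) does the rest.
    have hzero := constant_of_derivWithin_zero
      (f := fun t => rlIntegral (1 - α) x t - ∫ s in (0 : ℝ)..t, f s) (a := 0) (b := T)
      (fun t ht => ((h t ht).sub (hasDerivWithinAt_integral_Icc hf ht)).differentiableWithinAt)
      (fun t ht => by
        have ht' : t ∈ Icc 0 T := ⟨ht.1, ht.2.le⟩
        have := ((h t ht').sub (hasDerivWithinAt_integral_Icc hf ht')).derivWithin
          (uniqueDiffOn_Icc hT t ht')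
        rwa [sub_self] at this) t ht
    simp only [rlIntegral_zero_right, intervalIntegral.integral_same, sub_zero] at hzero
    linarith
  · intro h t ht
    have e : ∀ u ∈ Icc 0 T, rlIntegral (1 - α) x u = ∫ s in (0 : ℝ)..u, f s := fun u hu => by
      rw [← rlIntegral_rlIntegral_one_sub h0 h1 hf hu]
      exact rlIntegral_congr hu.1 fun s hs => h s ⟨hs.1, hs.2.trans hu.2⟩
    exact (hasDerivWithinAt_integral_Icc hf ht).congr e (e t ht)

theorem isSolution_iff {n : ℕ} {α lam T v : ℝ} (h0 : 0 < α) (h1 : α < 1) (hv : 0 < v)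
    (hT : 0 < T) (τ : Fin n → ℝ) (hτ : ∀ j, 0 ≤ τ j) (hτv : ∀ j, τ j ≤ v)
    (b : Fin n → C(Icc (0 : ℝ) T, ℝ)) (g : Fin n → C(Icc (-v) T, ℝ) → C(Icc (-v) T, ℝ))
    {ψ : C(Icc (-v) (0 : ℝ), ℝ)} (hψ : evalOn ψ 0 = 0) (x : C(Icc (-v) T, ℝ)) :
    IsSolution α lam τ b g ψ x ↔ (∀ t ∈ Icc (-v) 0, evalOn x t = evalOn ψ t) ∧
      restrictNonneg hv x =
        rlOperator h0 (delayTerm τ hτ hτv b g x - lam • restrictNonneg hv x) := by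
  unfold IsSolution
  refine and_congr_right fun hinit => ?_
  set N := delayTerm τ hτ hτv b g x
  set y := restrictNonneg hv x with hy
  have hx0 : evalOn x 0 = 0 := by rw [hinit 0 ⟨by linarith, le_rfl⟩, hψ]
  have hxc : ContinuousOn (evalOn x) (Icc 0 T) :=
    (continuousOn_evalOn x).mono (Icc_subset_Icc_left (by linarith))
  have hφ : ∀ t ∈ Icc 0 T, evalOn (N - lam • y) t =
      (∑ j, evalOn (b j) t * evalOn (g j x) (t - τ j)) - lam * evalOn x t := fun t ht => by
    rw [evalOn_of_mem _ ht, ContinuousMap.sub_apply, ContinuousMap.smul_apply, smul_eq_mul,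
      delayTerm_apply, ← evalOn_coe y, evalOn_restrictNonneg hv x ht]
  have hcap := hasCaputoDerivAt_iff_eq_rlIntegral h0 h1 hT hxc
    (continuousOn_evalOn (N - lam • y)) hx0
  have hop : y = rlOperator h0 (N - lam • y) ↔
      ∀ t ∈ Icc 0 T, evalOn x t = rlIntegral α (evalOn (N - lam • y)) t := by
    rw [ContinuousMap.ext_iff]
    refine ⟨fun h t ht => ?_, fun h t => ?_⟩
    · rw [← evalOn_restrictNonneg hv x ht, evalOn_of_mem _ ht, h ⟨t, ht⟩]
      rfl
    · rw [← evalOn_coe y, evalOn_restrictNonneg hv x t.2]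
      exact h t t.2
  rw [hop, ← hcap]
  refine forall₂_congr fun t ht => ⟨?_, fun h => ⟨_, h, ?_⟩⟩
  · rintro ⟨d, hd, hde⟩
    rwa [hφ t ht, ← hde, add_sub_cancel_right]
  · rw [hφ t ht, sub_add_cancel]

/-! ### Gluing the initial function to the solution -/

/-- The function on `[-v, T]` equal to `ψ` on `[-v, 0]` and to `ψ 0 + y` on `[0, T]`, if
`y 0 = 0`. -/
noncomputable def glue {v T : ℝ} (hv : 0 ≤ v) (hT : 0 ≤ T) (ψ : C(Icc (-v) (0 : ℝ), ℝ))
    (y : C(Icc (0 : ℝ) T, ℝ)) : C(Icc (-v) T, ℝ) :=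
  ψ.comp ⟨fun t : Icc (-v) T => ⟨min t 0, le_min t.2.1 (neg_nonpos.2 hv), min_le_right _ _⟩, by fun_prop⟩ +
    y.comp ⟨fun t : Icc (-v) T => ⟨max t 0, le_max_right _ _, max_le t.2.2 hT⟩, by fun_prop⟩

theorem norm_glue_sub_le {v T : ℝ} (hv : 0 ≤ v) (hT : 0 ≤ T) (ψ₁ ψ₂ : C(Icc (-v) (0 : ℝ), ℝ))
    (y₁ y₂ : C(Icc (0 : ℝ) T, ℝ)) :
    ‖glue hv hT ψ₁ y₁ - glue hv hT ψ₂ y₂‖ ≤ ‖ψ₁ - ψ₂‖ + ‖y₁ - y₂‖ := by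
  refine (ContinuousMap.norm_le _ (by positivity)).2 fun t => ?_
  have h1 := (ψ₁ - ψ₂).norm_coe_le_norm
    ⟨min t 0, le_min t.2.1 (neg_nonpos.2 hv), min_le_right _ _⟩
  have h2 := (y₁ - y₂).norm_coe_le_norm ⟨max t 0, le_max_right _ _, max_le t.2.2 hT⟩
  refine le_trans (le_of_eq ?_) ((norm_add_le _ _).trans (add_le_add h1 h2))
  congr 1
  simp only [glue, ContinuousMap.sub_apply, ContinuousMap.add_apply, ContinuousMap.comp_apply,
    ContinuousMap.coe_mk]
  ring

theorem eq_glue_iff {v T : ℝ} (hv : 0 < v) (hT : 0 ≤ T) {ψ : C(Icc (-v) (0 : ℝ), ℝ)}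
    (hψ : evalOn ψ 0 = 0) {y : C(Icc (0 : ℝ) T, ℝ)} (hy : evalOn y 0 = 0)
    (x : C(Icc (-v) T, ℝ)) :
    x = glue hv.le hT ψ y ↔
      (∀ t ∈ Icc (-v) 0, evalOn x t = evalOn ψ t) ∧ restrictNonneg hv x = y := by
  have hg : ∀ t : Icc (-v) T,
      glue hv.le hT ψ y t = evalOn ψ (min t 0) + evalOn y (max t 0) := fun t => by
    rw [evalOn_of_mem ψ ⟨le_min t.2.1 (neg_nonpos.2 hv.le), min_le_right _ _⟩,
      evalOn_of_mem y ⟨le_max_right _ _, max_le t.2.2 hT⟩]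
    rfl
  constructor
  · rintro rfl
    refine ⟨fun t ht => ?_, ?_⟩
    · rw [evalOn_of_mem _ ⟨ht.1, ht.2.trans hT⟩, hg]
      simp [ht.2, hy]
    · ext t
      rw [← evalOn_coe, evalOn_restrictNonneg hv _ t.2,
        evalOn_of_mem _ ⟨by linarith [t.2.1], t.2.2⟩, hg]
      simp [t.2.1, hψ, evalOn_coe]
  · rintro ⟨h1, h2⟩
    ext t
    rw [hg, ← evalOn_coe]
    rcases le_total (t : ℝ) 0 with ht | ht
    · rw [min_eq_left ht, max_eq_right ht, hy, add_zero, h1 t ⟨t.2.1, ht⟩]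
    · rw [min_eq_right ht, max_eq_left ht, hψ, zero_add, ← h2,
        evalOn_restrictNonneg hv x ⟨ht, t.2.2⟩]

/-! ### The fixed point argument -/

theorem corollary1 (n : ℕ) (α lam T v : ℝ) (hα0 : 0 < α) (hα1 : α < 1) (hlam : 0 < lam)
    (τ : Fin n → ℝ) (hτ : ∀ j, 0 ≤ τ j) (hvτ : IsGreatest (Set.range τ) v)
    (hv : 0 < v) (hvT : v ≤ T)
    (b : Fin n → C(Set.Icc (0 : ℝ) T, ℝ))
    (g : Fin n → C(Set.Icc (-v) T, ℝ) → C(Set.Icc (-v) T, ℝ))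
    (l : Fin n → ℝ) (hl : ∀ j, 0 < l j)
    (hg : ∀ j x y, ‖g j x - g j y‖ ≤ l j * ‖x - y‖)
    (hg0 : ∀ j, g j 0 ≠ 0)
    (hsmall : T ^ α * ∑ j, ‖b j‖ * l j < Real.Gamma (α + 1)) :
    ∃ S : {ψ : C(Set.Icc (-v) (0 : ℝ), ℝ) // evalOn ψ 0 = 0} → C(Set.Icc (-v) T, ℝ),
      (∀ ψ x, IsSolution α lam τ b g ψ.1 x ↔ x = S ψ) ∧
      Continuous S ∧
      ∀ ψ₁ ψ₂, ‖restrictNonneg hv (S ψ₁) - restrictNonneg hv (S ψ₂)‖ ≤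
        (T ^ α * ∑ j, ‖b j‖ * l j) / (Real.Gamma (α + 1) - T ^ α * ∑ j, ‖b j‖ * l j) *
          ‖ψ₁.1 - ψ₂.1‖ := by
  have hT : 0 < T := hv.trans_le hvT
  have hτv : ∀ j, τ j ≤ v := fun j => hvτ.2 ⟨j, rfl⟩
  have hG : 0 < Real.Gamma (α + 1) := Real.Gamma_pos_of_pos (by linarith)
  set B := ∑ j, ‖b j‖ * l j with hB
  have hB0 : 0 ≤ B := Finset.sum_nonneg fun j _ => mul_nonneg (norm_nonneg _) (hl j).le
  set q := T ^ α / Real.Gamma (α + 1) * B with hq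
  have hTα : 0 ≤ T ^ α := Real.rpow_nonneg hT.le _
  have hq0 : 0 ≤ q := by positivity
  have hq1 : q < 1 := by
    rw [hq, div_mul_eq_mul_div]
    exact (div_lt_one hG).2 hsmall
  set N := delayTerm τ hτ hτv b g with hN
  choose R hR using exists_linear_equation hα0 hα1 hlam.le hT.le
  have hR0 : ∀ h, evalOn (R h) 0 = 0 := fun h => by
    rw [hR h, evalOn_of_mem _ ⟨le_rfl, hT.le⟩]
    exact rlIntegral_zero_right _ _
  have hRuniq : ∀ h y, y = rlOperator hα0 (h - lam • y) ↔ y = R h := by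
    refine fun h y => ⟨fun hy => ?_, fun hy => by rw [hy]; exact hR h⟩
    have := norm_sub_le_of_linear_equation hα0 hα1 hlam.le hT.le hy (hR h)
    rwa [sub_self, norm_zero, mul_zero, norm_le_zero_iff, sub_eq_zero] at this
  have hRN : ∀ x y, ‖R (N x) - R (N y)‖ ≤ q * ‖x - y‖ := fun x y => by
    refine (norm_sub_le_of_linear_equation hα0 hα1 hlam.le hT.le (hR _) (hR _)).trans ?_
    rw [hq, mul_assoc]
    exact mul_le_mul_of_nonneg_left (norm_delayTerm_sub_le τ hτ hτv b g hg x y) (by positivity)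
  have hsol : ∀ (ψ : {ψ : C(Set.Icc (-v) (0 : ℝ), ℝ) // evalOn ψ 0 = 0}) x,
      IsSolution α lam τ b g ψ.1 x ↔ x = glue hv.le hT.le ψ.1 (R (N x)) := fun ψ x => by
    rw [isSolution_iff hα0 hα1 hv hT τ hτ hτv b g ψ.2, eq_glue_iff hv hT.le ψ.2 (hR0 _), hRuniq]
  -- From ‖x₁ - x₂‖ ≤ ‖ψ₁ - ψ₂‖ + q ‖x₁ - x₂‖; this gives both uniqueness and continuity in ψ.
  have hdiff : ∀ ψ₁ ψ₂ x₁ x₂, x₁ = glue hv.le hT.le ψ₁ (R (N x₁)) →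
      x₂ = glue hv.le hT.le ψ₂ (R (N x₂)) → ‖x₁ - x₂‖ ≤ ‖ψ₁ - ψ₂‖ / (1 - q) := by
    intro ψ₁ ψ₂ x₁ x₂ h₁ h₂
    have h := norm_glue_sub_le hv.le hT.le ψ₁ ψ₂ (R (N x₁)) (R (N x₂))
    rw [← h₁, ← h₂] at h
    rw [le_div_iff₀ (by linarith)]
    linarith [hRN x₁ x₂]
  have hex : ∀ ψ : {ψ : C(Set.Icc (-v) (0 : ℝ), ℝ) // evalOn ψ 0 = 0},
      ∃ x, glue hv.le hT.le ψ.1 (R (N x)) = x := fun ψ =>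
    exists_fixed_point_of_norm_sub_le hq0 hq1 _ fun x y =>
      (norm_glue_sub_le hv.le hT.le ψ.1 ψ.1 _ _).trans (by simpa using hRN x y)
  choose S hS using hex
  refine ⟨S, fun ψ x => ?_, ?_, fun ψ₁ ψ₂ => ?_⟩
  · rw [hsol]
    refine ⟨fun hx => ?_, fun hx => by rw [hx]; exact (hS ψ).symm⟩
    have := hdiff ψ.1 ψ.1 x (S ψ) hx (hS ψ).symm
    rwa [sub_self, norm_zero, zero_div, norm_le_zero_iff, sub_eq_zero] at this
  · refine (LipschitzWith.of_dist_le_mul (K := ⟨1 / (1 - q), by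
      have : 0 ≤ 1 - q := by linarith
      positivity⟩) fun ψ₁ ψ₂ => ?_).continuous
    rw [dist_eq_norm, Subtype.dist_eq, dist_eq_norm]
    refine (hdiff _ _ _ _ (hS ψ₁).symm (hS ψ₂).symm).trans_eq ?_
    change _ = 1 / (1 - q) * _
    ring
  -- On [0, T] the ψ term of the glued function is absent, so the factor q is gained over the bound
  -- on [-v, T].
  · have hr : ∀ ψ, restrictNonneg hv (S ψ) = R (N (S ψ)) := fun ψ =>
      ((eq_glue_iff hv hT.le ψ.2 (hR0 _) _).1 (hS ψ).symm).2
    rw [hr, hr]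
    refine (hRN _ _).trans ((mul_le_mul_of_nonneg_left
      (hdiff _ _ _ _ (hS ψ₁).symm (hS ψ₂).symm) hq0).trans_eq ?_)
    have e : T ^ α * B = q * Real.Gamma (α + 1) := by
      rw [hq]; field_simp
    have h1q : 1 - q ≠ 0 := by linarith
    have e2 : Real.Gamma (α + 1) - q * Real.Gamma (α + 1) = (1 - q) * Real.Gamma (α + 1) := by
      ring
    rw [e, e2]
    field_simp
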